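/- **Theorem.** Let $M$ be an effect divisoid. Then the category $\mathsf{AConv}_M$ of abstract $M$-convex sets and $M$-affine maps is an effectus in total form. **Definitions.** A *partial commutative monoid* is a set $M$ with an element $0$ and a partial binary operation $\oplus$ (write $a\perp b$ when $a\oplus b$ is defined) such that: if $a\perp b$ then $b\perp a$ and $a\oplus b=b\oplus a$; if $a\perp b$ and $a\oplus b\perp c$ then $b\perp c$, $a\perp b\oplus c$ and $(a\oplus b)\oplus c=a\oplus(b\oplus c)$; and $0\perp a$ with $0\oplus a=a$. Write $a\le b$ if $a\oplus c=b$ for some $c$. An *effect algebra* is a partial commutative monoid with an element $1$ such that for every $a$ there is a unique $a^\perp$ with $a\oplus a^\perp=1$, and $a\perp 1$ implies $a=0$. An *effect monoid* is an effect algebra with an associative binary operation $\odot$ with unit $1$ such that, whenever $a\perp b$ and $c\perp d$, the sum $(a\odot c)\oplus(b\odot c)\oplus(a\odot d)\oplus(b\odot d)$ is defined and equals $(a\oplus b)\odot(c\oplus d)$. An *effect divisoid* is an effect monoid with a partial binary operation $(a,b)\mapsto a/b$, defined if and only if $a\le b$, such that 1. $a/b$ is the unique element of $M$ with $a/b\le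 b/b$ and $b\odot(a/b)=a$; 2. $a\le a/a$; 3. $(a/a)/(a/a)=a/a$. For an effect monoid $M$ and a set $X$, let $\mathcal D_M X$ be the set of functions $p\colon X\to M$ of finite support with $\bigoplus_{x}p(x)=1$ (the finite partial sum of the values, which has to be defined). It is a monad on the category of sets, with $(\mathcal D_M f)(p)(y)=\bigoplus_{x;\,f(x)=y}p(x)$, with unit $\eta(x)$ the function that is $1$ at $x$ and $0$ elsewhere, and with multiplication $\mu(\Phi)(x)=\bigoplus_{\varphi}\Phi(\varphi)\odot\varphi(x)$. An *abstract $M$-convex set* is a set $X$ with a map $h\colon\mathcal D_M X\to X$ such that $h\circ\eta=\mathrm{id}$ and $h\circ\mu=h\circ\mathcal D_M h$; a map $f\colon X\to Y$ is *$M$-affine* if $f\circ h_X=h_Y\circ\mathcal D_M f$. So $\mathsf{AConv}_M$ is the Eilenberg–Moore category of $\mathcal D_M$. A category $C$ is an *effectus in total form* if 1. $C$ has finite coproducts and a final object $1$; 2. for all objects $X,Y$, with $\kappa_i$ the coprojections and $!$ the unique maps to $1$, the commutative squares $$(!+\mathrm{id})\circ(\mathrm{id}+!)=(\mathrm{id}+!)\circ(!+\mathrm{id})\colon\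 X+Y\to 1+1,$$ through $X+1$ on the left-hand side and through $1+Y$ on the right-hand side, and $$\kappa_1\circ{!}=(!+!)\circ\kappa_1\colon\ X\to 1+1,$$ through $1$ on the left-hand side and through $X+Y$ on the right-hand side, are pullbacks; 3. the two maps $[\kappa_1,\kappa_2,\kappa_2],\,[\kappa_2,\kappa_1,\kappa_2]\colon 1+1+1\to 1+1$ are jointly monic. -/

import Mathlib

open CategoryTheory CategoryTheory.Limits

universe u v w x

namespace Effectus

/-! ### Partial commutative monoids, effect algebras, effect monoids, effect divisoids -/

/-- A partial commutative monoid. The partial operation is `osum a b : Option M`;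
`osum a b = some c` says that `a` and `b` are summable with sum `c`, and `osum a b = none` that the
sum is undefined. -/
class PCM (M : Type u) extends Zero M where
  osum : M → M → Option M
  osum_comm : ∀ {a b c : M}, osum a b = some c → osum b a = some c
  osum_assoc : ∀ {a b c s t : M}, osum a b = some s → osum s c = some t →
    ∃ r, osum b c = some r ∧ osum a r = some t
  zero_osum : ∀ a : M, osum 0 a = some a

/-- The algebraic preorder of a partial commutative monoid. -/
def OLe {M : Type u} [PCM M] (a b : M) : Prop := ∃ c, PCM.osum a c = some b

theorem OLe.refl {M : Type u} [PCM M] (a : M) : OLe a a :=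
  ⟨0, PCM.osum_comm (PCM.zero_osum a)⟩

/-- An effect algebra. -/
class EffectAlgebra (M : Type u) extends PCM M, One M where
  existsUnique_orthocomplement : ∀ a : M, ∃! b : M, osum a b = some 1
  eq_zero_of_osum_one : ∀ a : M, (osum a 1).isSome → a = 0

/-- An effect monoid; the total multiplication is written `*`. -/
class EffectMonoid (M : Type u) extends EffectAlgebra M, Monoid M where
  distrib : ∀ {a b c d s t : M}, osum a b = some s → osum c d = some t →
    (((osum (a * c) (b * c)).bind fun x => osum x (a * d)).bind fun y => osum y (b * d))
      = some (s * t)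

/-- An effect divisoid: an effect monoid with a partial division `rdiv a b _` (read `a / b`),
defined exactly when `a ≤ b`. -/
class EffectDivisoid (M : Type u) extends EffectMonoid M where
  rdiv : ∀ a b : M, OLe a b → M
  rdiv_le : ∀ (a b : M) (h : OLe a b), OLe (rdiv a b h) (rdiv b b (OLe.refl b))
  mul_rdiv : ∀ (a b : M) (h : OLe a b), b * rdiv a b h = a
  rdiv_unique : ∀ (a b : M) (h : OLe a b) (c : M),
    OLe c (rdiv b b (OLe.refl b)) → b * c = a → c = rdiv a b h
  le_rdiv_self : ∀ a : M, OLe a (rdiv a a (OLe.refl a))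
  rdiv_rdiv_self : ∀ a : M,
    rdiv (rdiv a a (OLe.refl a)) (rdiv a a (OLe.refl a)) (OLe.refl (rdiv a a (OLe.refl a)))
      = rdiv a a (OLe.refl a)

/-! ### Finite partial sums -/

/-- `M` together with an extra element `none` for the value of an undefined sum. With the undefined
value absorbing, this is a total commutative monoid, so a finite partial sum `⊕ᵢ aᵢ` in `M` is the
usual finite sum of the elements `OptSum.of aᵢ`; it exists and equals `s` when that sum
is `OptSum.of s`. -/
def OptSum (M : Type u) : Type u := Option M

/-- The value of an undefined sum. -/
def OptSum.undef {M : Type u} : OptSum M := none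

/-- The inclusion of `M` into `OptSum M`. -/
def OptSum.of {M : Type u} (a : M) : OptSum M := some a

theorem OptSum.of_injective {M : Type u} : Function.Injective (OptSum.of : M → OptSum M) :=
  Option.some_injective M

/-- The value of a defined sum. -/
def OptSum.val {M : Type u} (x : OptSum M) (h : ∃ a, x = OptSum.of a) : M :=
  Option.get x (by obtain ⟨a, rfl⟩ := h; rfl)

theorem OptSum.of_val {M : Type u} (x : OptSum M) (h : ∃ a, x = OptSum.of a) :
    OptSum.of (x.val h) = x := by
  obtain ⟨a, rfl⟩ := h; rfl

theorem OptSum.cases' {M : Type u} (x : OptSum M) : x = OptSum.undef ∨ ∃ a, x = OptSum.of a := by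
  cases x with
  | none => exact Or.inl rfl
  | some a => exact Or.inr ⟨a, rfl⟩

section PCM

variable {M : Type u} [PCM M]

instance : Zero (OptSum M) := ⟨OptSum.of 0⟩

instance : Add (OptSum M) :=
  ⟨fun x y => Option.bind x fun a => Option.bind y fun b => PCM.osum a b⟩

theorem OptSum.of_zero : OptSum.of (0 : M) = 0 := rfl

theorem OptSum.of_add_of (a b : M) : OptSum.of a + OptSum.of b = PCM.osum a b := rfl

theorem OptSum.none_add (y : OptSum M) : (OptSum.undef : OptSum M) + y = OptSum.undef := rfl

theorem OptSum.add_none (x : OptSum M) : x + OptSum.undef = OptSum.undef := by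
  cases x <;> rfl

theorem OptSum.add_comm' (x y : OptSum M) : x + y = y + x := by
  rcases x.cases' with rfl | ⟨a, rfl⟩
  · rw [OptSum.none_add, OptSum.add_none]
  rcases y.cases' with rfl | ⟨b, rfl⟩
  · rw [OptSum.none_add, OptSum.add_none]
  change PCM.osum a b = PCM.osum b a
  cases h : PCM.osum a b with
  | some c => exact (PCM.osum_comm h).symm
  | none =>
    cases h' : PCM.osum b a with
    | none => rfl
    | some c => rw [PCM.osum_comm h'] at h; exact h.symm

theorem OptSum.exists_of_add_eq {x y : OptSum M} {s : M} (h : x + y = OptSum.of s) :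
    ∃ a b, x = OptSum.of a ∧ y = OptSum.of b ∧ PCM.osum a b = some s := by
  rcases x.cases' with rfl | ⟨a, rfl⟩
  · rw [OptSum.none_add] at h; exact absurd h (by rintro ⟨⟩)
  rcases y.cases' with rfl | ⟨b, rfl⟩
  · rw [OptSum.add_none] at h; exact absurd h (by rintro ⟨⟩)
  exact ⟨a, b, rfl, rfl, h⟩

theorem OptSum.assoc_of_eq {x y z : OptSum M} {t : M} (h : x + y + z = OptSum.of t) :
    x + (y + z) = OptSum.of t := by
  obtain ⟨s, c, hs, rfl, hst⟩ := OptSum.exists_of_add_eq h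
  obtain ⟨a, b, rfl, rfl, hab⟩ := OptSum.exists_of_add_eq hs
  obtain ⟨r, hr, hr'⟩ := PCM.osum_assoc hab hst
  have : OptSum.of b + OptSum.of c = OptSum.of r := hr
  rw [this]; exact hr'

instance : AddCommMonoid (OptSum M) where
  add_assoc x y z := by
    rcases (x + y + z).cases' with h | ⟨t, h⟩
    · rcases (x + (y + z)).cases' with h' | ⟨t, h'⟩
      · rw [h, h']
      · have h2 : z + y + x = OptSum.of t := by
          rw [OptSum.add_comm' _ x, OptSum.add_comm' z y]; exact h'
        have h3 := OptSum.assoc_of_eq h2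
        rw [OptSum.add_comm' z, OptSum.add_comm' y x] at h3
        rw [h', h3]
    · rw [h, OptSum.assoc_of_eq h]
  zero_add x := by
    rcases x.cases' with rfl | ⟨a, rfl⟩
    · exact OptSum.add_none _
    · exact PCM.zero_osum a
  add_zero x := by
    rcases x.cases' with rfl | ⟨a, rfl⟩
    · rfl
    · exact PCM.osum_comm (PCM.zero_osum a)
  add_comm := OptSum.add_comm'
  nsmul := nsmulRec

theorem OptSum.exists_of_mem {ι : Type v} {s : Finset ι} {f : ι → OptSum M} {t : M}
    (h : ∑ i ∈ s, f i = OptSum.of t) {i : ι} (hi : i ∈ s) : ∃ a, f i = OptSum.of a := by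
  classical
  rw [← Finset.add_sum_erase s f hi] at h
  obtain ⟨a, _, ha, _⟩ := OptSum.exists_of_add_eq h
  exact ⟨a, ha⟩

theorem OptSum.exists_of_subset {ι : Type v} {s s' : Finset ι} {f : ι → OptSum M} {t : M}
    (h : ∑ i ∈ s, f i = OptSum.of t) (hs : s' ⊆ s) : ∃ a, ∑ i ∈ s', f i = OptSum.of a := by
  classical
  rw [← Finset.sum_sdiff hs] at h
  obtain ⟨_, a, _, ha, _⟩ := OptSum.exists_of_add_eq h
  exact ⟨a, ha⟩

theorem OptSum.finsum_eq_sum {ι : Type v} {f : ι → M} {s : Finset ι}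
    (h : ∀ i, i ∉ s → f i = 0) : ∑ᶠ i, OptSum.of (f i) = ∑ i ∈ s, OptSum.of (f i) := by
  refine finsum_eq_sum_of_support_subset _ fun i hi => ?_
  by_contra hn
  exact hi (congrArg OptSum.of (h i hn))

end PCM

section EffectAlgebra

variable {M : Type u} [EffectAlgebra M]

theorem osum_left_cancel {a b c s : M} (h : PCM.osum a b = some s) (h' : PCM.osum a c = some s) :
    b = c := by
  obtain ⟨d, hd, _⟩ := EffectAlgebra.existsUnique_orthocomplement s
  obtain ⟨e, -, he⟩ := EffectAlgebra.existsUnique_orthocomplement (M := M) a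
  obtain ⟨k, hk, -⟩ := PCM.osum_assoc (PCM.osum_comm h) hd
  obtain ⟨r, hr, hr'⟩ := PCM.osum_assoc h hd
  obtain ⟨r', hr2, hr2'⟩ := PCM.osum_assoc h' hd
  have e1 : r = r' := (he _ hr').trans (he _ hr2').symm
  subst e1
  -- both `b` and `c` are the orthocomplement of `a ⊕ d`
  obtain ⟨w, hw, hw'⟩ := PCM.osum_assoc hr (PCM.osum_comm hr')
  obtain ⟨w', hw2, hw2'⟩ := PCM.osum_assoc hr2 (PCM.osum_comm hr2')
  have e2 : w = w' := Option.some_injective _ (hw.symm.trans hw2)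
  subst e2
  exact (EffectAlgebra.existsUnique_orthocomplement w).unique
    (PCM.osum_comm hw') (PCM.osum_comm hw2')

theorem eq_zero_of_osum_self {a b : M} (h : PCM.osum a b = some a) : b = 0 :=
  osum_left_cancel h (PCM.osum_comm (PCM.zero_osum a))

theorem eq_zero_of_osum_eq_zero {a b : M} (h : PCM.osum a b = some 0) : a = 0 := by
  obtain ⟨r, hr, hr'⟩ := PCM.osum_assoc h (PCM.zero_osum 1)
  have : b = 0 := EffectAlgebra.eq_zero_of_osum_one b (by rw [hr]; rfl)
  subst this
  exact Option.some_injective _ ((PCM.osum_comm (PCM.zero_osum a)).symm.trans h)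

end EffectAlgebra

section EffectMonoid

variable {M : Type u} [EffectMonoid M]

theorem OptSum.distrib {a b c d s t : M} (h : OptSum.of a + OptSum.of b = OptSum.of s)
    (h' : OptSum.of c + OptSum.of d = OptSum.of t) :
    OptSum.of (a * c) + OptSum.of (b * c) + OptSum.of (a * d) + OptSum.of (b * d)
      = OptSum.of (s * t) := by
  have key := EffectMonoid.distrib h h'
  obtain ⟨y, hy, hy'⟩ := Option.bind_eq_some_iff.1 key
  obtain ⟨x, hx, hx'⟩ := Option.bind_eq_some_iff.1 hy
  have e1 : OptSum.of (a * c) + OptSum.of (b * c) = OptSum.of x := hx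
  have e2 : OptSum.of x + OptSum.of (a * d) = OptSum.of y := hx'
  rw [e1, e2]; exact hy'

protected theorem mul_zero (a : M) : a * (0 : M) = 0 := by
  have h : OptSum.of a + OptSum.of (0 : M) = OptSum.of a := add_zero (OptSum.of a)
  have h0 : OptSum.of (0 : M) + OptSum.of (0 : M) = OptSum.of 0 := add_zero (0 : OptSum M)
  have key := OptSum.distrib h h0
  rw [add_assoc, add_assoc] at key
  obtain ⟨x, y, hx, hy, hxy⟩ := OptSum.exists_of_add_eq key
  have hx' : a * 0 = x := OptSum.of_injective hx
  subst hx'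
  have hy0 := eq_zero_of_osum_self hxy
  subst hy0
  rw [add_left_comm] at hy
  obtain ⟨x, y, hx, _, hxy⟩ := OptSum.exists_of_add_eq hy
  rw [OptSum.of_injective hx]
  exact eq_zero_of_osum_eq_zero hxy

protected theorem zero_mul (a : M) : (0 : M) * a = 0 := by
  have h : OptSum.of a + OptSum.of (0 : M) = OptSum.of a := add_zero (OptSum.of a)
  have h0 : OptSum.of (0 : M) + OptSum.of (0 : M) = OptSum.of 0 := add_zero (0 : OptSum M)
  have key := OptSum.distrib h0 h
  rw [add_assoc, add_assoc] at key
  obtain ⟨x, y, hx, hy, hxy⟩ := OptSum.exists_of_add_eq key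
  have hx' : 0 * a = x := OptSum.of_injective hx
  subst hx'
  have hy0 := eq_zero_of_osum_self hxy
  subst hy0
  obtain ⟨x, y, hx, _, hxy⟩ := OptSum.exists_of_add_eq hy
  rw [OptSum.of_injective hx]
  exact eq_zero_of_osum_eq_zero hxy

theorem OptSum.mul_add {a c d t : M} (h : OptSum.of c + OptSum.of d = OptSum.of t) :
    OptSum.of (a * c) + OptSum.of (a * d) = OptSum.of (a * t) := by
  have key := OptSum.distrib (add_zero (OptSum.of a)) h
  simpa only [Effectus.zero_mul, OptSum.of_zero, add_zero] using key

theorem OptSum.add_mul {a b c s : M} (h : OptSum.of a + OptSum.of b = OptSum.of s) :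
    OptSum.of (a * c) + OptSum.of (b * c) = OptSum.of (s * c) := by
  have key := OptSum.distrib h (add_zero (OptSum.of c))
  simpa only [Effectus.mul_zero, OptSum.of_zero, add_zero] using key

theorem OptSum.mul_sum {ι : Type v} (a : M) (s : Finset ι) (f : ι → M) {t : M}
    (h : ∑ i ∈ s, OptSum.of (f i) = OptSum.of t) :
    ∑ i ∈ s, OptSum.of (a * f i) = OptSum.of (a * t) := by
  classical
  induction s using Finset.induction_on generalizing t with
  | empty =>
    have : t = 0 := (OptSum.of_injective h).symm
    rw [this, Effectus.mul_zero]; rfl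
  | insert i s hi ih =>
    rw [Finset.sum_insert hi] at h ⊢
    obtain ⟨x, y, hx, hy, hxy⟩ := OptSum.exists_of_add_eq h
    rw [ih hy]
    rw [hy] at h
    exact OptSum.mul_add h

theorem OptSum.sum_mul {ι : Type v} (a : M) (s : Finset ι) (f : ι → M) {t : M}
    (h : ∑ i ∈ s, OptSum.of (f i) = OptSum.of t) :
    ∑ i ∈ s, OptSum.of (f i * a) = OptSum.of (t * a) := by
  classical
  induction s using Finset.induction_on generalizing t with
  | empty =>
    have : t = 0 := (OptSum.of_injective h).symm
    rw [this, Effectus.zero_mul]; rfl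
  | insert i s hi ih =>
    rw [Finset.sum_insert hi] at h ⊢
    obtain ⟨x, y, hx, hy, hxy⟩ := OptSum.exists_of_add_eq h
    rw [ih hy]
    rw [hy] at h
    exact OptSum.add_mul h

end EffectMonoid

/-! ### The distribution monad -/

/-- A formal `M`-convex combination over `X`: a finitely supported function `p : X → M`
with `⊕ₓ p x = 1`. -/
structure Dist (M : Type u) [EffectMonoid M] (X : Type v) where
  toFun : X → M
  finite_support : {x | toFun x ≠ 0}.Finite
  sum_eq_one : ∑ᶠ x, OptSum.of (toFun x) = OptSum.of 1

namespace Dist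

variable {M : Type u} [EffectMonoid M] {X : Type v} {Y : Type w} {Z : Type x}

instance : CoeFun (Dist M X) fun _ => X → M := ⟨Dist.toFun⟩

theorem ext {p q : Dist M X} (h : ∀ x, p x = q x) : p = q := by
  cases p; cases q
  congr
  exact funext h

/-- The support of a formal convex combination, as a finite set. -/
noncomputable def supp (p : Dist M X) : Finset X := p.finite_support.toFinset

theorem eq_zero_of_notMem {p : Dist M X} {x : X} (h : x ∉ p.supp) : p x = 0 := by
  by_contra hn
  exact h (p.finite_support.mem_toFinset.2 hn)

theorem sum_eq (p : Dist M X) {s : Finset X} (hs : p.supp ⊆ s) :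
    ∑ x ∈ s, OptSum.of (p x) = OptSum.of 1 := by
  rw [← OptSum.finsum_eq_sum fun i hi => eq_zero_of_notMem fun h => hi (hs h)]
  exact p.sum_eq_one

/-- The unit `η x = 1|x⟩`. -/
noncomputable def unit (x : X) : Dist M X where
  toFun y := by classical exact if y = x then 1 else 0
  finite_support := (Set.finite_singleton x).subset fun y hy => by
    by_contra hn
    exact hy (if_neg hn)
  sum_eq_one := by
    rw [finsum_eq_single _ x fun y hy => by rw [if_neg hy]; rfl, if_pos rfl]

theorem unit_self (x : X) : (unit x : Dist M X) x = 1 := if_pos rfl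

theorem unit_ne {x y : X} (h : y ≠ x) : (unit x : Dist M X) y = 0 := if_neg h

theorem exists_map (f : X → Y) (p : Dist M X) (y : Y) :
    ∃ a : M, ∑ᶠ (x : X) (_ : f x = y), OptSum.of (p x) = OptSum.of a := by
  classical
  have h : ∑ᶠ (x : X) (_ : f x = y), OptSum.of (p x)
      = ∑ x ∈ p.supp.filter (fun x => f x = y), OptSum.of (p x) := by
    refine finsum_cond_eq_sum_of_cond_iff _ fun {x} hx => ?_
    have hm : x ∈ p.supp := by
      by_contra hn
      exact hx (by rw [eq_zero_of_notMem hn]; rfl)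
    simp [hm]
  rw [h]
  exact OptSum.exists_of_subset (p.sum_eq subset_rfl) (Finset.filter_subset _ _)

theorem sum_mix (p : Dist M X) (k : X → Dist M Y) {T : Finset Y}
    (hT : ∀ x ∈ p.supp, (k x).supp ⊆ T) :
    ∑ y ∈ T, ∑ x ∈ p.supp, OptSum.of (p x * k x y) = OptSum.of 1 := by
  rw [Finset.sum_comm, ← p.sum_eq subset_rfl]
  refine Finset.sum_congr rfl fun x hx => ?_
  rw [OptSum.mul_sum (p x) T (k x) ((k x).sum_eq (hT x hx)), mul_one]

theorem finsum_mix (p : Dist M X) (k : X → Dist M Y) (y : Y) {s : Finset X} (hs : p.supp ⊆ s) :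
    ∑ᶠ x, OptSum.of (p x * k x y) = ∑ x ∈ s, OptSum.of (p x * k x y) :=
  OptSum.finsum_eq_sum fun i hi => by
    rw [eq_zero_of_notMem fun h => hi (hs h), Effectus.zero_mul]

theorem exists_mix (p : Dist M X) (k : X → Dist M Y) (y : Y) :
    ∃ a : M, ∑ᶠ x, OptSum.of (p x * k x y) = OptSum.of a := by
  classical
  rw [finsum_mix p k y subset_rfl]
  refine OptSum.exists_of_mem (sum_mix p k (T := insert y (p.supp.biUnion fun x => (k x).supp))
    fun x hx => ?_) (Finset.mem_insert_self _ _)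
  exact (Finset.subset_biUnion_of_mem (fun x => (k x).supp) hx).trans (Finset.subset_insert _ _)

theorem mix_eq_zero (p : Dist M X) (k : X → Dist M Y) (y : Y)
    (h : ∀ x ∈ p.supp, y ∉ (k x).supp) : ∑ᶠ x, OptSum.of (p x * k x y) = OptSum.of 0 := by
  rw [finsum_mix p k y subset_rfl]
  refine Finset.sum_eq_zero fun x hx => ?_
  rw [eq_zero_of_notMem (h x hx), Effectus.mul_zero]; rfl

/-- The mixture `⊕ₓ p x ⊙ k x` of a family `k` of formal convex combinations. -/
noncomputable def mix (p : Dist M X) (k : X → Dist M Y) : Dist M Y where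
  toFun y := (∑ᶠ x, OptSum.of (p x * k x y)).val (exists_mix p k y)
  finite_support := by
    classical
    refine (p.supp.biUnion fun x => (k x).supp).finite_toSet.subset fun y hy => ?_
    by_contra hn
    refine hy (OptSum.of_injective ?_)
    rw [OptSum.of_val]
    refine mix_eq_zero p k y fun x hx hy' => hn ?_
    exact Finset.mem_coe.2 (Finset.mem_biUnion.2 ⟨x, hx, hy'⟩)
  sum_eq_one := by
    classical
    have h : ∀ x ∈ p.supp, (k x).supp ⊆ p.supp.biUnion fun x => (k x).supp := fun x hx =>
      Finset.subset_biUnion_of_mem (fun x => (k x).supp) hx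
    rw [OptSum.finsum_eq_sum (s := p.supp.biUnion fun x => (k x).supp), ← sum_mix p k h]
    · refine Finset.sum_congr rfl fun y _ => ?_
      rw [OptSum.of_val, finsum_mix p k y subset_rfl]
    · intro y hy
      apply OptSum.of_injective
      rw [OptSum.of_val]
      exact mix_eq_zero p k y fun x hx hy' => hy (Finset.mem_biUnion.2 ⟨x, hx, hy'⟩)

theorem of_mix (p : Dist M X) (k : X → Dist M Y) (y : Y) :
    OptSum.of (p.mix k y) = ∑ᶠ x, OptSum.of (p x * k x y) :=
  OptSum.of_val _ (exists_mix p k y)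

theorem finsum_fiber (f : X → Y) (p : Dist M X) (y : Y) :
    ∑ᶠ (x : X) (_ : f x = y), OptSum.of (p x)
      = OptSum.of (p.mix (fun x => unit (f x)) y) := by
  rw [of_mix]
  refine finsum_congr fun x => ?_
  by_cases h : f x = y
  · subst h
    rw [unit_self, mul_one]
    simp
  · rw [unit_ne (Ne.symm h), Effectus.mul_zero]
    simp [h, OptSum.of_zero]

/-- The action of `Dist M` on maps: `(map f p) y = ⊕_{x ; f x = y} p x`. -/
noncomputable def map (f : X → Y) (p : Dist M X) : Dist M Y where
  toFun y := (∑ᶠ (x : X) (_ : f x = y), OptSum.of (p x)).val (exists_map f p y)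
  finite_support := by
    convert (p.mix fun x => unit (f x)).finite_support using 5 with y
    apply OptSum.of_injective
    rw [OptSum.of_val, finsum_fiber]
  sum_eq_one := by
    rw [← (p.mix fun x => unit (f x)).sum_eq_one]
    refine finsum_congr fun y => ?_
    rw [OptSum.of_val, finsum_fiber]

theorem map_eq_mix (f : X → Y) (p : Dist M X) : map f p = p.mix fun x => unit (f x) := by
  refine Dist.ext fun y => ?_
  apply OptSum.of_injective
  rw [← finsum_fiber]
  exact OptSum.of_val _ (exists_map f p y)

/-- The multiplication `μ`: `(join Φ) x = ⊕_φ Φ φ ⊙ φ x`. -/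
noncomputable def join (Φ : Dist M (Dist M X)) : Dist M X := Φ.mix fun φ => φ

theorem unit_mix (x : X) (k : X → Dist M Y) : (unit x).mix k = k x := by
  refine Dist.ext fun y => ?_
  apply OptSum.of_injective
  rw [of_mix, finsum_eq_single _ x fun z hz => by
    rw [unit_ne hz, Effectus.zero_mul]; rfl, unit_self, one_mul]

theorem mix_unit (p : Dist M X) : p.mix unit = p := by
  refine Dist.ext fun y => ?_
  apply OptSum.of_injective
  rw [of_mix, finsum_eq_single _ y fun z hz => by
    rw [unit_ne hz.symm, Effectus.mul_zero]; rfl, unit_self, mul_one]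

theorem mix_mix (p : Dist M X) (k : X → Dist M Y) (l : Y → Dist M Z) :
    (p.mix k).mix l = p.mix fun x => (k x).mix l := by
  classical
  refine Dist.ext fun z => ?_
  apply OptSum.of_injective
  set T : Finset Y := (p.mix k).supp ∪ p.supp.biUnion fun x => (k x).supp with hT
  have hTk : ∀ x ∈ p.supp, (k x).supp ⊆ T := fun x hx =>
    (Finset.subset_biUnion_of_mem (fun x => (k x).supp) hx).trans Finset.subset_union_right
  rw [of_mix, of_mix, finsum_mix _ _ _ (Finset.subset_union_left : _ ⊆ T),
    finsum_mix p _ z subset_rfl]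
  have h1 : ∀ y ∈ T, OptSum.of (p.mix k y * l y z)
      = ∑ x ∈ p.supp, OptSum.of (p x * k x y * l y z) := fun y _ => by
    refine (OptSum.sum_mul (l y z) p.supp (fun x => p x * k x y) ?_).symm
    rw [of_mix, finsum_mix p k y subset_rfl]
  have h2 : ∀ x ∈ p.supp, OptSum.of (p x * (k x).mix l z)
      = ∑ y ∈ T, OptSum.of (p x * k x y * l y z) := fun x hx => by
    simp only [mul_assoc]
    refine (OptSum.mul_sum (p x) T (fun y => k x y * l y z) ?_).symm
    rw [of_mix, finsum_mix (k x) l z (hTk x hx)]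
  rw [Finset.sum_congr rfl h1, Finset.sum_congr rfl h2, Finset.sum_comm]

theorem map_mix (p : Dist M X) (k : X → Dist M Y) (f : Y → Z) :
    map f (p.mix k) = p.mix fun x => map f (k x) := by
  simp only [map_eq_mix, mix_mix]

theorem mix_map (p : Dist M X) (f : X → Y) (k : Y → Dist M Z) :
    (map f p).mix k = p.mix fun x => k (f x) := by
  simp only [map_eq_mix, mix_mix, unit_mix]

end Dist

/-- The distribution monad `D_M` on the category of sets. -/
noncomputable def distMonad (M : Type u) [EffectMonoid M] : Monad (Type u) where
  obj X := Dist M X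
  map f := ↾(Dist.map f)
  map_id X := by
    ext p
    exact (Dist.map_eq_mix _ p).trans p.mix_unit
  map_comp f g := by
    ext p
    change Dist.map (fun x => g (f x)) p = Dist.map g (Dist.map f p)
    rw [Dist.map_eq_mix g, Dist.mix_map, Dist.map_eq_mix]
  η :=
    { app := fun X => ↾(Dist.unit : X → Dist M X)
      naturality := fun X Y f => by
        ext x
        change Dist.unit (f x) = Dist.map f (Dist.unit x)
        rw [Dist.map_eq_mix, Dist.unit_mix] }
  μ :=
    { app := fun X => ↾(Dist.join : Dist M (Dist M X) → Dist M X)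
      naturality := fun X Y f => by
        ext Φ
        change Dist.join (Dist.map (Dist.map f) Φ) = Dist.map f (Dist.join Φ)
        rw [Dist.join, Dist.join, Dist.mix_map, Dist.map_mix] }
  assoc X := by
    ext Φ
    change Dist.join (Dist.map Dist.join Φ) = Dist.join (Dist.join Φ)
    simp only [Dist.join, Dist.mix_map, Dist.mix_mix]
  left_unit X := by
    ext p
    exact Dist.unit_mix p _
  right_unit X := by
    ext p
    change Dist.join (Dist.map Dist.unit p) = p
    rw [Dist.join, Dist.mix_map, Dist.mix_unit]

/-- The category of abstract `M`-convex sets and `M`-affine maps: the Eilenberg–Moore category of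
the distribution monad. -/
abbrev AConv (M : Type u) [EffectMonoid M] : Type (u + 1) := (distMonad M).Algebra

/-! ### Effectuses -/

/-- An effectus in total form. Here `X ⨿ Y` is the coproduct, `⊤_ C` the final object and
`terminal.from X` the unique map to it; the coproduct `1 + 1 + 1` is bracketed to the left. -/
class IsEffectusInTotalForm (C : Type u) [Category.{v} C] : Prop where
  [hasFiniteCoproducts : HasFiniteCoproducts C]
  [hasTerminal : HasTerminal C]
  isPullback_left : ∀ X Y : C,
    IsPullback
      (coprod.map (𝟙 X) (terminal.from Y) : X ⨿ Y ⟶ X ⨿ ⊤_ C)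
      (coprod.map (terminal.from X) (𝟙 Y) : X ⨿ Y ⟶ (⊤_ C) ⨿ Y)
      (coprod.map (terminal.from X) (𝟙 (⊤_ C)) : X ⨿ ⊤_ C ⟶ (⊤_ C) ⨿ ⊤_ C)
      (coprod.map (𝟙 (⊤_ C)) (terminal.from Y) : (⊤_ C) ⨿ Y ⟶ (⊤_ C) ⨿ ⊤_ C)
  isPullback_right : ∀ X Y : C,
    IsPullback
      (terminal.from X : X ⟶ ⊤_ C)
      (coprod.inl : X ⟶ X ⨿ Y)
      (coprod.inl : ⊤_ C ⟶ (⊤_ C) ⨿ ⊤_ C)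
      (coprod.map (terminal.from X) (terminal.from Y) : X ⨿ Y ⟶ (⊤_ C) ⨿ ⊤_ C)
  jointly_monic : ∀ (Z : C) (f g : Z ⟶ ((⊤_ C) ⨿ ⊤_ C) ⨿ ⊤_ C),
    f ≫ coprod.desc (coprod.desc coprod.inl coprod.inr) coprod.inr
      = g ≫ (coprod.desc (coprod.desc coprod.inl coprod.inr) coprod.inr :
          ((⊤_ C) ⨿ ⊤_ C) ⨿ ⊤_ C ⟶ (⊤_ C) ⨿ ⊤_ C) →
    f ≫ coprod.desc (coprod.desc coprod.inr coprod.inl) coprod.inr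
      = g ≫ (coprod.desc (coprod.desc coprod.inr coprod.inl) coprod.inr :
          ((⊤_ C) ⨿ ⊤_ C) ⨿ ⊤_ C ⟶ (⊤_ C) ⨿ ⊤_ C) →
    f = g

end Effectus

namespace Effectus

namespace Dist

variable {M : Type u} [EffectMonoid M] {X : Type v} {Y : Type w} {Z : Type x}

/-! Every element of a coproduct `X ⨿ Y` is represented by a formal convex combination over the
disjoint union of the carriers (`evalCoprod_surjective`), usually in many ways. Over `1 + 1` the
representation is unique, because `1 + 1` maps to the free convex set on two points
(`evalCoprod_terminal_injective`). So an equation in `1 + 1` is an equation between weights, and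
most of the axioms become statements about weights.

The second pullback holds by positivity: if the total weight on `Y` is zero, every weight on `Y` is
zero. Joint monicity holds by cancellation: the two maps reveal the weights of the first two points
of `1 + 1 + 1`, which determine the third. For existence in the first pullback, the `X`-weights of
one representative and the `Y`-weights of the other have complementary totals, so they glue
(`exists_glue`).

Uniqueness in the first pullback is where division enters. Dividing the `Y`-weights of a
representative of `z` by their total `t` gives a formal convex combination over `Y`; with `y` its
value, `z` is fixed by `id + const y`. Symmetrically `z'` is fixed by `const x + id` for some `x`.
If `z` and `z'` agree in `X + 1` and `1 + Y`, then `id + const y` sends `z'` to `z`, since it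
factors through `X + 1`, and `const x + id` sends `z` to `z'`. The two endomaps commute, so applying
both to `z'` in either order gives `z = z'`. -/

theorem map_map (p : Dist M X) (f : X → Y) (g : Y → Z) :
    map g (map f p) = map (fun x => g (f x)) p := by
  rw [map_eq_mix g, mix_map, map_eq_mix]

theorem map_unit (f : X → Y) (x : X) : map f (unit x : Dist M X) = unit (f x) := by
  rw [map_eq_mix, unit_mix]

end Dist

/-! ### Evaluation, affine maps and free convex sets. -/

namespace AConv

open Effectus.Dist

variable {M : Type u} [EffectMonoid M]

/-- The structure Dist.map of an abstract convex set: evaluation of formal convex combinations. -/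
def eval (X : AConv M) (p : Dist M X.A) : X.A := X.a p

theorem eval_unit (X : AConv M) (x : X.A) : X.eval (unit x) = x :=
  ConcreteCategory.congr_hom X.unit x

theorem eval_join (X : AConv M) (Φ : Dist M (Dist M X.A)) :
    X.eval (join Φ) = X.eval (Dist.map X.eval Φ) :=
  ConcreteCategory.congr_hom X.assoc Φ

/-- The associativity law of the algebra for an indexed family: a mixture may be evaluated inside
first. This is the form in which associativity is used below. -/
theorem eval_mix (X : AConv M) {S : Type u} (p : Dist M S) (k : S → Dist M X.A) :
    X.eval (p.mix k) = X.eval (Dist.map (fun s => X.eval (k s)) p) := by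
  have h := X.eval_join (Dist.map k p)
  rwa [join, mix_map, map_map] at h

/-- The underlying function of an affine map. -/
def ap {X Y : AConv M} (f : X ⟶ Y) (x : X.A) : Y.A := f.f x

theorem ap_eval {X Y : AConv M} (f : X ⟶ Y) (p : Dist M X.A) :
    ap f (X.eval p) = Y.eval (Dist.map (ap f) p) :=
  (ConcreteCategory.congr_hom f.h p).symm

theorem ap_comp {X Y Z : AConv M} (f : X ⟶ Y) (g : Y ⟶ Z) (x : X.A) :
    ap (f ≫ g) x = ap g (ap f x) := rfl

theorem ap_id {X : AConv M} (x : X.A) : ap (𝟙 X) x = x := rfl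

theorem hom_ext {X Y : AConv M} {f g : X ⟶ Y} (h : ∀ x, ap f x = ap g x) : f = g := by
  apply Monad.Algebra.Hom.ext'
  ext x
  exact h x

/-- An abstract convex set given by a function evaluating formal convex combinations. -/
abbrev of (A : Type u) (h : Dist M A → A) (h_unit : ∀ x, h (unit x) = x)
    (h_join : ∀ Φ, h (join Φ) = h (Dist.map h Φ)) : AConv M where
  A := A
  a := ↾h
  unit := by ext x; exact h_unit x
  assoc := by ext x; exact h_join x

/-- An affine Dist.map given by its underlying function. -/
def homOf {X Y : AConv M} (f : X.A → Y.A)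
    (h : ∀ p, f (X.eval p) = Y.eval (Dist.map f p)) : X ⟶ Y where
  f := ↾f
  h := by ext p; exact (h p).symm

/-- The free abstract convex set on a set. -/
noncomputable abbrev free (M : Type u) [EffectMonoid M] (S : Type u) : AConv M :=
  of (Dist M S) join (fun p => unit_mix p _) fun Φ => by simp only [join, mix_map, mix_mix]

theorem eval_free {S : Type u} (Φ : Dist M (free M S).A) : (free M S).eval Φ = join Φ := rfl

/-- The affine Dist.map on a free abstract convex set extending a function on generators. -/
noncomputable def extend (X : AConv M) {S : Type u} (f : S → X.A) : free M S ⟶ X :=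
  homOf (fun p => X.eval (Dist.map f p)) fun Φ => by
    rw [eval_free, join, map_mix, eval_mix]

theorem ap_extend (X : AConv M) {S : Type u} (f : S → X.A) (p : Dist M S) :
    ap (X.extend f) p = X.eval (Dist.map f p) := rfl

/-! ### Coproducts -/

section Coproduct

variable (X Y : AConv M)

/-- Two formal convex combinations over the disjoint union of `X` and `Y` are identified when every
pair of affine maps evaluates them equally. -/
def coprodSetoid : Setoid (Dist M (X.A ⊕ Y.A)) where
  r p q := ∀ (Z : AConv M) (f : X ⟶ Z) (g : Y ⟶ Z),
    Z.eval (Dist.map (Sum.elim (ap f) (ap g)) p) = Z.eval (Dist.map (Sum.elim (ap f) (ap g)) q)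
  iseqv := ⟨fun _ _ _ _ => rfl, fun h Z f g => (h Z f g).symm,
    fun h h' Z f g => (h Z f g).trans (h' Z f g)⟩

/-- The carrier of the coproduct. -/
def CoprodCarrier : Type u := Quotient (coprodSetoid X Y)

variable {X Y} in
/-- The class of a formal convex combination in the coproduct. -/
def coprodMk (p : Dist M (X.A ⊕ Y.A)) : CoprodCarrier X Y :=
  Quotient.mk (coprodSetoid X Y) p

variable {X Y} in
theorem coprodMk_surjective (z : CoprodCarrier X Y) : ∃ p, coprodMk p = z :=
  Quotient.exists_rep z

variable {X Y} in
/-- A formal convex combination representing an element of the coproduct. -/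
noncomputable def coprodRep (z : CoprodCarrier X Y) : Dist M (X.A ⊕ Y.A) := Quotient.out z

variable {X Y} in
/-- The function out of the coproduct induced by two affine maps. -/
noncomputable def coprodDesc {Z : AConv M} (f : X ⟶ Z) (g : Y ⟶ Z) (z : CoprodCarrier X Y) : Z.A :=
  Z.eval (Dist.map (Sum.elim (ap f) (ap g)) (coprodRep z))

variable {X Y} in
theorem coprodDesc_mk {Z : AConv M} (f : X ⟶ Z) (g : Y ⟶ Z) (p : Dist M (X.A ⊕ Y.A)) :
    coprodDesc f g (coprodMk p) = Z.eval (Dist.map (Sum.elim (ap f) (ap g)) p) :=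
  Quotient.mk_out (s := coprodSetoid X Y) p Z f g

variable {X Y} in
-- The quotient is defined so that the induced maps jointly separate points. Every law of the
-- coproduct is therefore checked after mapping to an arbitrary `Z`, and no explicit description of
-- the generated congruence is needed.
theorem coprodCarrier_ext {z z' : CoprodCarrier X Y}
    (h : ∀ (Z : AConv M) (f : X ⟶ Z) (g : Y ⟶ Z), coprodDesc f g z = coprodDesc f g z') :
    z = z' := by
  obtain ⟨p, rfl⟩ := coprodMk_surjective z
  obtain ⟨q, rfl⟩ := coprodMk_surjective z'
  refine Quotient.sound fun Z f g => ?_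
  rw [← coprodDesc_mk, ← coprodDesc_mk]
  exact h Z f g

/-- Evaluation of formal convex combinations in the coproduct. -/
noncomputable def coprodEval (P : Dist M (CoprodCarrier X Y)) : CoprodCarrier X Y :=
  coprodMk (P.mix coprodRep)

variable {X Y} in
-- The representatives chosen in `coprodEval` are invisible to induced maps, so these are affine
-- even before the algebra laws of the coproduct are known.
theorem coprodDesc_eval {Z : AConv M} (f : X ⟶ Z) (g : Y ⟶ Z) (P : Dist M (CoprodCarrier X Y)) :
    coprodDesc f g (coprodEval X Y P) = Z.eval (Dist.map (coprodDesc f g) P) := by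
  rw [coprodEval, coprodDesc_mk, map_mix, eval_mix]
  rfl

/-- The coproduct of two abstract convex sets. -/
noncomputable abbrev coproduct : AConv M :=
  of (CoprodCarrier X Y) (coprodEval X Y)
    (fun z => coprodCarrier_ext fun Z f g => by rw [coprodDesc_eval, map_unit, eval_unit])
    (fun Φ => coprodCarrier_ext fun Z f g => by
      rw [coprodDesc_eval, coprodDesc_eval, map_map, join, map_mix, eval_mix]
      simp only [coprodDesc_eval])

/-- The first coprojection. -/
noncomputable def coproductInl : X ⟶ coproduct X Y :=
  homOf (fun x => (coprodMk (unit (Sum.inl x)))) fun p =>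
    coprodCarrier_ext fun Z f g => by
      refine Eq.trans ?_ (coprodDesc_eval f g _).symm
      rw [coprodDesc_mk, map_unit, eval_unit, map_map]
      simp only [coprodDesc_mk, map_unit, eval_unit, Sum.elim_inl, ap_eval]

/-- The second coprojection. -/
noncomputable def coproductInr : Y ⟶ coproduct X Y :=
  homOf (fun y => (coprodMk (unit (Sum.inr y)))) fun p =>
    coprodCarrier_ext fun Z f g => by
      refine Eq.trans ?_ (coprodDesc_eval f g _).symm
      rw [coprodDesc_mk, map_unit, eval_unit, map_map]
      simp only [coprodDesc_mk, map_unit, eval_unit, Sum.elim_inr, ap_eval]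

/-- The images of the coprojections generate the coproduct, which makes induced maps unique. -/
theorem exists_eval_coproduct (z : (coproduct X Y).A) :
    ∃ p : Dist M (X.A ⊕ Y.A), z = (coproduct X Y).eval
      (Dist.map (Sum.elim (ap (coproductInl X Y)) (ap (coproductInr X Y))) p) := by
  obtain ⟨p, rfl⟩ := coprodMk_surjective z
  refine ⟨p, coprodCarrier_ext fun Z f g => ?_⟩
  refine Eq.trans ?_ (coprodDesc_eval f g _).symm
  rw [coprodDesc_mk, map_map]
  congr 2
  funext s
  rcases s with x | y
  · change ap f x = coprodDesc f g (coprodMk (unit (Sum.inl x)))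
    rw [coprodDesc_mk, map_unit, eval_unit, Sum.elim_inl]
  · change ap g y = coprodDesc f g (coprodMk (unit (Sum.inr y)))
    rw [coprodDesc_mk, map_unit, eval_unit, Sum.elim_inr]

/-- The affine Dist.map out of the coproduct induced by two affine maps. -/
noncomputable def coproductDesc {X Y Z : AConv M} (f : X ⟶ Z) (g : Y ⟶ Z) : coproduct X Y ⟶ Z :=
  homOf (coprodDesc f g) (coprodDesc_eval f g)

theorem inl_coproductDesc {X Y Z : AConv M} (f : X ⟶ Z) (g : Y ⟶ Z) :
    coproductInl X Y ≫ coproductDesc f g = f :=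
  hom_ext fun x => (coprodDesc_mk f g _).trans (by rw [map_unit, eval_unit, Sum.elim_inl])

theorem inr_coproductDesc {X Y Z : AConv M} (f : X ⟶ Z) (g : Y ⟶ Z) :
    coproductInr X Y ≫ coproductDesc f g = g :=
  hom_ext fun x => (coprodDesc_mk f g _).trans (by rw [map_unit, eval_unit, Sum.elim_inr])

theorem coproduct_hom_ext {X Y Z : AConv M} {h h' : coproduct X Y ⟶ Z}
    (hl : coproductInl X Y ≫ h = coproductInl X Y ≫ h')
    (hr : coproductInr X Y ≫ h = coproductInr X Y ≫ h') : h = h' := by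
  refine hom_ext fun z => ?_
  obtain ⟨p, rfl⟩ := exists_eval_coproduct X Y z
  rw [ap_eval, ap_eval, map_map, map_map]
  congr 2
  funext s
  rcases s with x | y
  · exact congrArg (fun k => ap k x) hl
  · exact congrArg (fun k => ap k y) hr

/-- The universal property of the coproduct. -/
noncomputable def isColimitCoproduct :
    IsColimit (BinaryCofan.mk (coproductInl X Y) (coproductInr X Y)) :=
  BinaryCofan.isColimitMk (fun s => coproductDesc s.inl s.inr)
    (fun s => inl_coproductDesc s.inl s.inr) (fun s => inr_coproductDesc s.inl s.inr)
    fun s _ hl hr => coproduct_hom_ext (hl.trans (inl_coproductDesc s.inl s.inr).symm)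
      (hr.trans (inr_coproductDesc s.inl s.inr).symm)

end Coproduct

/-! ### Finite coproducts and the final object. -/

instance : HasBinaryCoproducts (AConv M) :=
  have : ∀ {X Y : AConv M}, HasColimit (pair X Y) := fun {X Y} => ⟨⟨⟨_, isColimitCoproduct X Y⟩⟩⟩
  hasBinaryCoproducts_of_hasColimit_pair _

instance : HasInitial (AConv M) :=
  IsInitial.hasInitial (X := free M PEmpty) <|
    IsInitial.ofUniqueHom (fun X => X.extend PEmpty.elim) fun X m => hom_ext fun p => by
      -- `p` is the join of its image under `unit`, so `m` is determined on generators, of which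
      -- there are none.
      have h := ap_eval m (Dist.map unit p)
      rw [eval_free, join, mix_map, mix_unit, map_map] at h
      rw [h, ap_extend]
      congr 2
      funext s
      exact s.elim

instance : HasFiniteCoproducts (AConv M) :=
  hasFiniteCoproducts_of_has_binary_and_initial

instance : HasTerminal (AConv M) where
  has_limit F := Monad.hasLimit_of_comp_forget_hasLimit F

noncomputable instance : Unique (⊤_ AConv M).A :=
  ((Types.isTerminalEquivUnique _)
    (IsTerminal.isTerminalObj (Monad.forget (distMonad M)) _ terminalIsTerminal))

end AConv
-- Cancellation and order in effect monoids.
theorem osum_right_cancel {M : Type u} [EffectAlgebra M] {a b c s : M}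
    (h : PCM.osum a c = some s) (h' : PCM.osum b c = some s) : a = b :=
  osum_left_cancel (PCM.osum_comm h) (PCM.osum_comm h')

theorem osum_zero {M : Type u} [PCM M] (a : M) : PCM.osum a 0 = some a :=
  PCM.osum_comm (PCM.zero_osum a)

theorem OLe.trans {M : Type u} [PCM M] {a b c : M} (h : OLe a b) (h' : OLe b c) : OLe a c := by
  obtain ⟨d, hd⟩ := h
  obtain ⟨e, he⟩ := h'
  obtain ⟨r, -, hr⟩ := PCM.osum_assoc hd he
  exact ⟨r, hr⟩

theorem OLe.of_right {M : Type u} [PCM M] {a b c : M} (h : PCM.osum a b = some c) : OLe b c :=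
  ⟨a, PCM.osum_comm h⟩

section EffectMonoid

variable {M : Type u} [EffectMonoid M]

theorem osum_mul_left (a : M) {c d t : M} (h : PCM.osum c d = some t) :
    PCM.osum (a * c) (a * d) = some (a * t) :=
  OptSum.mul_add h

theorem mul_ole (a b : M) : OLe (a * b) a := by
  obtain ⟨c, hc, -⟩ := EffectAlgebra.existsUnique_orthocomplement b
  refine ⟨a * c, ?_⟩
  simpa only [mul_one] using osum_mul_left a hc

end EffectMonoid

/-! ### Division -/

section EffectDivisoid

variable {M : Type u} [EffectDivisoid M]

open EffectDivisoid

/-- The element `a / a`, a right unit for `a`. -/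
def ceil (a : M) : M := rdiv a a (OLe.refl a)

theorem mul_ceil (a : M) : a * ceil a = a := mul_rdiv a a _

/-- Both factors are the quotient of the common product by `a`, which is unique below `a / a`. -/
theorem mul_left_cancel_of_ole_ceil {a c d : M} (hc : OLe c (ceil a)) (hd : OLe d (ceil a))
    (h : a * c = a * d) : c = d :=
  have had : OLe (a * d) a := mul_ole a d
  (rdiv_unique (a * d) a had c hc h).trans (rdiv_unique (a * d) a had d hd rfl).symm

theorem ceil_zero : ceil (0 : M) = 0 :=
  (rdiv_unique 0 0 (OLe.refl 0) 0 ⟨_, PCM.zero_osum _⟩ (Effectus.mul_zero 0)).symm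

/-- Multiplication by `a` sends both `ceil a` and `1` to `a`, so nothing is left for their
difference. -/
theorem mul_eq_zero_of_ceil_osum {a c : M} (h : PCM.osum (ceil a) c = some 1) : a * c = 0 := by
  have h' := osum_mul_left a h
  rw [mul_ceil, mul_one] at h'
  exact eq_zero_of_osum_self h'

/-- A finite partial sum can be divided by its value, term by term. -/
theorem exists_division {ι : Type v} (s : Finset ι) (b : ι → M) (t : M)
    (h : ∑ i ∈ s, OptSum.of (b i) = OptSum.of t) :
    ∃ c : ι → M, ∑ i ∈ s, OptSum.of (c i) = OptSum.of (ceil t) ∧ ∀ i ∈ s, t * c i = b i := by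
  classical
  induction s using Finset.induction_on generalizing t with
  | empty =>
    have ht : t = 0 := (OptSum.of_injective h).symm
    subst ht
    exact ⟨b, by rw [ceil_zero]; rfl, by simp⟩
  | insert i s hi ih =>
    rw [Finset.sum_insert hi] at h
    obtain ⟨x, r, hx, hr, hxr⟩ := OptSum.exists_of_add_eq h
    obtain rfl := OptSum.of_injective hx
    obtain ⟨c, hc, hcb⟩ := ih r hr
    have hit : OLe (b i) t := ⟨r, hxr⟩
    obtain ⟨d, hd⟩ : OLe (rdiv (b i) t hit) (ceil t) := rdiv_le _ _ _
    -- The remainder `d` of `ceil t` after removing the first quotient plays the role of `r / t`.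
    have htd : t * d = r := by
      have h' := osum_mul_left t hd
      rw [mul_rdiv, mul_ceil] at h'
      exact osum_left_cancel h' hxr
    -- The recursive quotients sum only to `ceil r`, so `d` must absorb it. After multiplication by
    -- `t` this reads `r * ceil r = r`, and `t` cancels below `ceil t`.
    have hdr : d * ceil r = d := by
      have hdt : OLe d (ceil t) := OLe.of_right hd
      refine mul_left_cancel_of_ole_ceil ((mul_ole _ _).trans hdt) hdt ?_
      rw [← mul_assoc, htd, mul_ceil]
    refine ⟨fun j => if j = i then rdiv (b i) t hit else d * c j, ?_, fun j hj => ?_⟩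
    · simp only [Finset.sum_insert hi, if_true]
      have : ∑ j ∈ s, OptSum.of (if j = i then rdiv (b i) t hit else d * c j)
          = OptSum.of d := by
        rw [← hdr, ← OptSum.mul_sum d s c hc]
        refine Finset.sum_congr rfl fun j hj => ?_
        rw [if_neg (ne_of_mem_of_not_mem hj hi), hdr]
      rw [this]
      exact hd
    · by_cases hji : j = i
      · subst hji
        simp only [if_true, mul_rdiv]
      · simp only [if_neg hji, ← mul_assoc, htd]
        exact hcb j ((Finset.mem_insert.1 hj).resolve_left hji)

/-- A finite partial sum over an inhabited index set is the product of its value with a formal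
convex combination. -/
theorem exists_dist_mul {ι : Type v} [Nonempty ι] (s : Finset ι) (b : ι → M) (t : M)
    (h : ∑ i ∈ s, OptSum.of (b i) = OptSum.of t) (hb : ∀ i ∉ s, b i = 0) :
    ∃ c : Dist M ι, ∀ i, t * c i = b i := by
  classical
  obtain ⟨z⟩ := ‹Nonempty ι›
  have hz : ∑ i ∈ insert z s, OptSum.of (b i) = OptSum.of t := by
    rw [← h]
    refine (Finset.sum_subset (Finset.subset_insert z s) fun i _ hi => ?_).symm
    rw [hb i hi]; rfl
  obtain ⟨c, hc, hcb⟩ := exists_division _ b t hz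
  -- The quotients sum to `ceil t`, not to `1`. Since `t * e = 0`, the missing weight `e` can be
  -- added at the point `z` without changing any product with `t`; this needs the index set
  -- inhabited.
  obtain ⟨e, he, -⟩ := EffectAlgebra.existsUnique_orthocomplement (ceil t)
  have hte := mul_eq_zero_of_ceil_osum he
  rw [← Finset.add_sum_erase _ _ (Finset.mem_insert_self z s)] at hc
  have h1 : OptSum.of (c z) + OptSum.of e
      + ∑ i ∈ (insert z s).erase z, OptSum.of (c i) = OptSum.of 1 := by
    rw [add_right_comm, hc]; exact he
  obtain ⟨d, _, hd, -, -⟩ := OptSum.exists_of_add_eq h1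
  have htd : t * d = b z := by
    have h' := osum_mul_left t hd
    rw [hte, osum_zero, hcb z (Finset.mem_insert_self z s)] at h'
    exact (Option.some_injective _ h').symm
  let f : ι → M := fun i => if i = z then d else if i ∈ s then c i else 0
  have hf : ∀ i ∉ insert z s, f i = 0 := fun i hi => by
    rw [Finset.mem_insert, not_or] at hi
    simp only [f, if_neg hi.1, if_neg hi.2]
  refine ⟨⟨f, (insert z s).finite_toSet.subset fun i hi => ?_, ?_⟩, fun i => ?_⟩
  · by_contra hn
    exact hi (hf i hn)
  · rw [OptSum.finsum_eq_sum hf, ← Finset.add_sum_erase _ _ (Finset.mem_insert_self z s), ← h1, hd]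
    congr 1
    · simp only [f, if_true]
    · refine Finset.sum_congr rfl fun i hi => ?_
      obtain ⟨hiz, his⟩ := Finset.mem_erase.1 hi
      simp only [f, if_neg hiz, if_pos ((Finset.mem_insert.1 his).resolve_left hiz)]
  · change t * f i = b i
    by_cases hiz : i = z
    · subst hiz
      simp only [f, if_true, htd]
    · by_cases his : i ∈ s
      · simp only [f, if_neg hiz, if_pos his, hcb i (Finset.mem_insert_of_mem his)]
      · simp only [f, if_neg hiz, if_neg his, Effectus.mul_zero, hb i his]

end EffectDivisoid

/-! ### Formal convex combinations over a disjoint union -/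

namespace Dist

section EffectMonoid

variable {M : Type u} [EffectMonoid M] {X : Type v} {Y : Type w} {Z : Type x}

theorem of_map_eq_sum (f : X → Y) (p : Dist M X) (y : Y) {s : Finset X} (hs : p.supp ⊆ s)
    [DecidablePred fun x => f x = y] :
    OptSum.of (map f p y) = ∑ x ∈ s with f x = y, OptSum.of (p x) := by
  rw [map_eq_mix, ← finsum_fiber]
  refine finsum_cond_eq_sum_of_cond_iff _ fun {x} hx => ?_
  have hm : x ∈ p.supp := by
    by_contra hn
    exact hx (by rw [eq_zero_of_notMem hn]; rfl)
  simp [hs hm]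

theorem map_apply_eq {f : X → Y} (p : Dist M X) {x : X} {y : Y} (h : ∀ x', f x' = y ↔ x' = x) :
    map f p y = p x := by
  apply OptSum.of_injective
  rw [map_eq_mix, ← finsum_fiber]
  simp only [h, finsum_cond_eq_left]

theorem map_apply_of_injective {f : X → Y} (hf : Function.Injective f) (p : Dist M X) (x : X) :
    map f p (f x) = p x :=
  map_apply_eq p fun _ => hf.eq_iff

theorem map_apply_of_notMem_range (f : X → Y) (p : Dist M X) (y : Y) (h : ∀ x, f x ≠ y) :
    map f p y = 0 := by
  apply OptSum.of_injective
  rw [map_eq_mix, ← finsum_fiber]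
  simp only [h, finsum_false, finsum_zero]
  rfl

theorem map_const (p : Dist M X) (y : Y) : map (fun _ => y) p = unit y := by
  refine Dist.ext fun z => OptSum.of_injective ?_
  rw [map_eq_mix, of_mix, finsum_mix _ _ _ subset_rfl,
    OptSum.sum_mul _ _ _ (p.sum_eq subset_rfl), one_mul]

theorem exists_supp_subset (p : Dist M (X ⊕ Y)) :
    ∃ (s : Finset X) (t : Finset Y), p.supp ⊆ s.disjSum t :=
  ⟨p.supp.toLeft, p.supp.toRight, Finset.toLeft_disjSum_toRight.symm.subset⟩

theorem apply_inl_eq_zero {p : Dist M (X ⊕ Y)} {s : Finset X} {t : Finset Y}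
    (h : p.supp ⊆ s.disjSum t) {x : X} (hx : x ∉ s) : p (Sum.inl x) = 0 :=
  eq_zero_of_notMem fun hn => hx (Finset.inl_mem_disjSum.1 (h hn))

theorem apply_inr_eq_zero {p : Dist M (X ⊕ Y)} {s : Finset X} {t : Finset Y}
    (h : p.supp ⊆ s.disjSum t) {y : Y} (hy : y ∉ t) : p (Sum.inr y) = 0 :=
  eq_zero_of_notMem fun hn => hy (Finset.inr_mem_disjSum.1 (h hn))

theorem of_map_sumMap_inl {X' : Type*} {Y' : Type*} [Subsingleton X'] (f : X → X') (g : Y → Y')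
    {p : Dist M (X ⊕ Y)} {s : Finset X} {t : Finset Y} (h : p.supp ⊆ s.disjSum t) (x : X') :
    OptSum.of (map (Sum.map f g) p (Sum.inl x)) = ∑ x ∈ s, OptSum.of (p (Sum.inl x)) := by
  classical
  rw [of_map_eq_sum _ _ _ h, Finset.sum_filter, Finset.sum_disjSum]
  simp [Subsingleton.elim _ x]

theorem of_map_sumMap_inr {X' : Type*} {Y' : Type*} [Subsingleton Y'] (f : X → X') (g : Y → Y')
    {p : Dist M (X ⊕ Y)} {s : Finset X} {t : Finset Y} (h : p.supp ⊆ s.disjSum t) (y : Y') :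
    OptSum.of (map (Sum.map f g) p (Sum.inr y)) = ∑ y ∈ t, OptSum.of (p (Sum.inr y)) := by
  classical
  rw [of_map_eq_sum _ _ _ h, Finset.sum_filter, Finset.sum_disjSum]
  simp [Subsingleton.elim _ y]

theorem map_sumMap_apply_inl {X' : Type*} {Y' : Type*} {f : X → X'} (hf : Function.Injective f)
    (g : Y → Y') (p : Dist M (X ⊕ Y)) (x : X) :
    map (Sum.map f g) p (Sum.inl (f x)) = p (Sum.inl x) :=
  map_apply_eq p <| by rintro (x' | y) <;> simp [hf.eq_iff]

theorem map_sumMap_apply_inr {X' : Type*} {Y' : Type*} (f : X → X') {g : Y → Y'}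
    (hg : Function.Injective g) (p : Dist M (X ⊕ Y)) (y : Y) :
    map (Sum.map f g) p (Sum.inr (g y)) = p (Sum.inr y) :=
  map_apply_eq p <| by rintro (x | y') <;> simp [hg.eq_iff]

/-- Two formal convex combinations over `X ⊕ 1` and `1 ⊕ Y` with the same image over `1 ⊕ 1` come
from one over `X ⊕ Y`. -/
theorem exists_glue {S T : Type*} [Unique S] [Unique T] (p : Dist M (X ⊕ T)) (q : Dist M (S ⊕ Y))
    (f : X → S) (g : Y → T) (h : map (Sum.map f (fun t => t)) p = map (Sum.map (fun t => t) g) q) :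
    ∃ r : Dist M (X ⊕ Y), map (Sum.map (fun x => x) g) r = p ∧ map (Sum.map f (fun y => y)) r = q := by
  obtain ⟨s, t, hp⟩ := exists_supp_subset p
  obtain ⟨s', t', hq⟩ := exists_supp_subset q
  let k : X ⊕ Y → M := Sum.elim (fun x => p (Sum.inl x)) fun y => q (Sum.inr y)
  have hk : ∀ i ∉ s.disjSum t', k i = 0 := by
    rintro (x | y) hi
    · exact apply_inl_eq_zero hp fun hx => hi (Finset.inl_mem_disjSum.2 hx)
    · exact apply_inr_eq_zero hq fun hy => hi (Finset.inr_mem_disjSum.2 hy)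
  have hl : ∑ x ∈ s, OptSum.of (p (Sum.inl x)) = OptSum.of (q (Sum.inl default)) := by
    rw [← of_map_sumMap_inl f (fun t => t) hp default, h,
      map_sumMap_apply_inl (f := fun t => t) Function.injective_id g]
  have hr : ∑ y ∈ t', OptSum.of (q (Sum.inr y)) = OptSum.of (p (Sum.inr default)) := by
    rw [← of_map_sumMap_inr (fun t => t) g hq default, ← h,
      map_sumMap_apply_inr f (g := fun t => t) Function.injective_id]
  -- The two numbers are the totals of the `X`-weights of `p` and of the `Y`-weights of `q`, so this
  -- is the normalisation of the glued combination `k`.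
  have hq1 : OptSum.of (q (Sum.inl default)) + OptSum.of (p (Sum.inr default)) = OptSum.of 1 := by
    have hq' : q.supp ⊆ (Finset.univ : Finset S).disjSum t' := fun i hi => by
      rcases i with i | y
      · simp [Unique.eq_default]
      · simpa using hq hi
    rw [← q.sum_eq hq', Finset.sum_disjSum, hr]
    simp
  let r : Dist M (X ⊕ Y) :=
    ⟨k, (s.disjSum t').finite_toSet.subset fun i hi => by
        by_contra hn
        exact hi (hk i hn), by
      rw [OptSum.finsum_eq_sum hk, Finset.sum_disjSum, ← hq1, ← hl, ← hr]
      rfl⟩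
  have hrs : r.supp ⊆ s.disjSum t' := fun i hi => by
    by_contra hn
    exact r.finite_support.mem_toFinset.1 hi (hk i hn)
  refine ⟨r, Dist.ext ?_, Dist.ext ?_⟩
  · rintro (x | y)
    · exact map_sumMap_apply_inl Function.injective_id g r x
    · apply OptSum.of_injective
      rw [of_map_sumMap_inr _ _ hrs, Subsingleton.elim y default, ← hr]
      rfl
  · rintro (x | y)
    · apply OptSum.of_injective
      rw [of_map_sumMap_inl _ _ hrs, Subsingleton.elim x default, ← hl]
      rfl
    · exact map_sumMap_apply_inr f Function.injective_id r y

/-- A formal convex combination over `X ⊕ Y` of total weight `1` on `X` comes from one over `X`. -/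
theorem exists_map_inl_eq {S : Type*} {T : Type*} [Unique T] (p : Dist M (X ⊕ Y))
    (f : X → S) (g : Y → T) (h : map (Sum.map f g) p (Sum.inr default) = 0) :
    ∃ q : Dist M X, map Sum.inl q = p := by
  obtain ⟨s, t, hp⟩ := exists_supp_subset p
  have ht : ∑ y ∈ t, OptSum.of (p (Sum.inr y)) = OptSum.of 0 := by
    rw [← of_map_sumMap_inr f g hp default, h]
  have h0 : ∀ y, p (Sum.inr y) = 0 := fun y => by
    by_cases hy : y ∈ t
    · classical
      rw [← Finset.add_sum_erase _ _ hy] at ht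
      obtain ⟨a, b, ha, -, hab⟩ := OptSum.exists_of_add_eq ht
      rw [OptSum.of_injective ha]
      exact eq_zero_of_osum_eq_zero hab
    · exact apply_inr_eq_zero hp hy
  have hs : ∀ x ∉ s, p (Sum.inl x) = 0 := fun x hx => apply_inl_eq_zero hp hx
  refine ⟨⟨fun x => p (Sum.inl x), s.finite_toSet.subset fun x hx => ?_, ?_⟩, Dist.ext ?_⟩
  · by_contra hn
    exact hx (hs x hn)
  · rw [OptSum.finsum_eq_sum hs, ← p.sum_eq hp, Finset.sum_disjSum]
    simp [h0, OptSum.of_zero]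
  · rintro (x | y)
    · exact map_apply_of_injective Sum.inl_injective _ x
    · rw [h0, map_apply_of_notMem_range _ _ _ (by simp)]

/-- A formal convex combination is determined by its values away from one point. -/
theorem ext_of_ne (z : X) {p q : Dist M X} (h : ∀ x, x ≠ z → p x = q x) : p = q := by
  classical
  refine Dist.ext fun x => ?_
  by_cases hx : x = z
  · subst hx
    have hp := p.sum_eq (s := insert x (p.supp ∪ q.supp))
      (Finset.subset_union_left.trans (Finset.subset_insert _ _))
    have hq := q.sum_eq (s := insert x (p.supp ∪ q.supp))
      (Finset.subset_union_right.trans (Finset.subset_insert _ _))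
    rw [← Finset.add_sum_erase _ _ (Finset.mem_insert_self _ _)] at hp hq
    -- Both values at `x` complete the same partial sum to `1`, so they agree by cancellation.
    have e : ∑ y ∈ (insert x (p.supp ∪ q.supp)).erase x, OptSum.of (p y)
        = ∑ y ∈ (insert x (p.supp ∪ q.supp)).erase x, OptSum.of (q y) :=
      Finset.sum_congr rfl fun y hy => by rw [h y (Finset.ne_of_mem_erase hy)]
    rw [e] at hp
    obtain ⟨a, b, ha, hb, hab⟩ := OptSum.exists_of_add_eq hp
    rw [hb] at hq
    rw [OptSum.of_injective ha]
    rw [← OptSum.of_injective ha] at hab ⊢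
    exact osum_right_cancel hab hq
  · exact h x hx

end EffectMonoid

section EffectDivisoid

variable {M : Type u} [EffectDivisoid M] {X : Type v} {Y : Type w}

/-- Here `c` is the `Y`-part of `p` divided by its total weight `a`. Replacing each point of `Y` by
`c` gives `y` the weight `a * c y`, its original one. -/
theorem exists_mix_inr [Nonempty Y] (p : Dist M (X ⊕ Y)) :
    ∃ c : Dist M Y, p.mix (Sum.elim (fun x => unit (Sum.inl x)) fun _ => map Sum.inr c) = p := by
  obtain ⟨s, t, hp⟩ := exists_supp_subset p
  obtain ⟨a, ha⟩ : ∃ a, ∑ y ∈ t, OptSum.of (p (Sum.inr y)) = OptSum.of a := by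
    have h1 := p.sum_eq hp
    rw [Finset.sum_disjSum] at h1
    obtain ⟨_, a, -, ha, -⟩ := OptSum.exists_of_add_eq h1
    exact ⟨a, ha⟩
  obtain ⟨c, hc⟩ := exists_dist_mul t (fun y => p (Sum.inr y)) a ha
    fun y hy => apply_inr_eq_zero hp hy
  refine ⟨c, Dist.ext fun z => OptSum.of_injective ?_⟩
  rw [of_mix, finsum_mix _ _ _ hp, Finset.sum_disjSum]
  simp only [Sum.elim_inl, Sum.elim_inr]
  rw [OptSum.sum_mul _ t _ ha]
  rcases z with x | y
  · rw [map_apply_of_notMem_range _ _ _ (by simp), Effectus.mul_zero, OptSum.of_zero, add_zero,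
      Finset.sum_eq_single x]
    · rw [unit_self, mul_one]
    · intro x' _ hx'
      rw [unit_ne (fun e => hx' (Sum.inl_injective e).symm), Effectus.mul_zero, OptSum.of_zero]
    · intro hx
      rw [apply_inl_eq_zero hp hx, Effectus.zero_mul, OptSum.of_zero]
  · rw [map_apply_of_injective Sum.inr_injective, hc, Finset.sum_eq_zero, zero_add]
    intro x _
    rw [unit_ne (by simp), Effectus.mul_zero, OptSum.of_zero]

end EffectDivisoid

end Dist

/-! ### Constant maps and pointwise pullback criteria. -/

namespace AConv

open Effectus.Dist

section EffectMonoid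

variable {M : Type u} [EffectMonoid M]

/-- The constant affine map with value `x`. -/
def const {X Y : AConv M} (x : X.A) : Y ⟶ X :=
  homOf (fun _ => x) fun p => by rw [Dist.map_const, eval_unit]

theorem ap_const {X Y : AConv M} (x : X.A) (y : Y.A) : ap (const x : Y ⟶ X) y = x := rfl

theorem terminal_hom_ext {X : AConv M} {f g : ⊤_ (AConv M) ⟶ X} (h : ap f default = ap g default) :
    f = g :=
  hom_ext fun s => by rwa [Subsingleton.elim s default]

/-- The monadic forgetful functor reflects pullbacks, so they can be tested on elements. -/
theorem isPullback_of_ap {P X Y Z : AConv M} {t : P ⟶ X} {l : P ⟶ Y} {r : X ⟶ Z} {b : Y ⟶ Z}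
    (w : t ≫ r = l ≫ b) (h_inj : ∀ z z', ap t z = ap t z' → ap l z = ap l z' → z = z')
    (h_surj : ∀ x y, ap r x = ap b y → ∃ z, ap t z = x ∧ ap l z = y) : IsPullback t l r b :=
  IsPullback.of_map (Monad.forget (distMonad M)) w <|
    (Types.isPullback_iff _ _ _ _).2
      ⟨congrArg Monad.Algebra.Hom.f w, fun z z' h => h_inj z z' h.1 h.2, h_surj⟩

/-! ### Elements of coproducts -/

/-- The inclusion of the disjoint union into the coproduct. -/
noncomputable def coprodIncl (X Y : AConv M) : X.A ⊕ Y.A → (X ⨿ Y).A :=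
  Sum.elim (ap coprod.inl) (ap coprod.inr)

/-- Evaluation in the coproduct of a formal convex combination over the disjoint union. -/
noncomputable def evalCoprod {X Y : AConv M} (p : Dist M (X.A ⊕ Y.A)) : (X ⨿ Y).A :=
  (X ⨿ Y).eval (Dist.map (coprodIncl X Y) p)

theorem ap_evalCoprod {X Y Z : AConv M} (f : X ⨿ Y ⟶ Z) (p : Dist M (X.A ⊕ Y.A)) :
    ap f (evalCoprod p)
      = Z.eval (Dist.map (Sum.elim (ap (coprod.inl ≫ f)) (ap (coprod.inr ≫ f))) p) := by
  rw [evalCoprod, ap_eval, map_map]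
  congr 2
  funext s
  rcases s with x | y <;> rfl

theorem evalCoprod_surjective {X Y : AConv M} (z : (X ⨿ Y).A) :
    ∃ p : Dist M (X.A ⊕ Y.A), evalCoprod p = z := by
  let d : X ⨿ Y ⟶ coproduct X Y := coprod.desc (coproductInl X Y) (coproductInr X Y)
  let e : coproduct X Y ⟶ X ⨿ Y := coproductDesc coprod.inl coprod.inr
  have hde : d ≫ e = 𝟙 _ := by
    apply coprod.hom_ext
    · rw [coprod.inl_desc_assoc, inl_coproductDesc, Category.comp_id]
    · rw [coprod.inr_desc_assoc, inr_coproductDesc, Category.comp_id]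
  obtain ⟨p, hp⟩ := exists_eval_coproduct X Y (ap d z)
  refine ⟨p, ?_⟩
  have h := congrArg (ap e) hp
  rw [← ap_comp, hde, ap_id, ap_eval, map_map] at h
  rw [h, evalCoprod]
  congr 2
  funext s
  rcases s with x | y
  · exact (congrArg (fun k => ap k x) (inl_coproductDesc coprod.inl coprod.inr)).symm
  · exact (congrArg (fun k => ap k y) (inr_coproductDesc coprod.inl coprod.inr)).symm

theorem ap_map_evalCoprod {X Y X' Y' : AConv M} (f : X ⟶ X') (g : Y ⟶ Y')
    (p : Dist M (X.A ⊕ Y.A)) :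
    ap (coprod.map f g) (evalCoprod p) = evalCoprod (Dist.map (Sum.map (ap f) (ap g)) p) := by
  rw [ap_evalCoprod, coprod.inl_map, coprod.inr_map, evalCoprod, map_map]
  congr 2
  funext s
  rcases s with x | y <;> rfl

theorem evalCoprod_map_inl {X Y : AConv M} (q : Dist M X.A) :
    evalCoprod (Dist.map Sum.inl q) = ap (coprod.inl : X ⟶ X ⨿ Y) (X.eval q) := by
  rw [evalCoprod, map_map, ap_eval]
  rfl

/-- The map `d` to the free convex set on two points sends the coprojected points to the generators,
and so recovers the weights. -/
theorem evalCoprod_terminal_injective :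
    Function.Injective (evalCoprod (X := ⊤_ (AConv M)) (Y := ⊤_ (AConv M))) := by
  let d : (⊤_ (AConv M)) ⨿ ⊤_ (AConv M) ⟶ free M ((⊤_ (AConv M)).A ⊕ (⊤_ (AConv M)).A) :=
    coprod.desc (const (unit (Sum.inl default))) (const (unit (Sum.inr default)))
  refine Function.LeftInverse.injective (g := ap d) fun p => ?_
  rw [ap_evalCoprod, coprod.inl_desc, coprod.inr_desc, eval_free, join, mix_map]
  refine Eq.trans ?_ p.mix_unit
  congr 1
  funext s
  rcases s with s | s <;> exact congrArg unit (congrArg _ (Subsingleton.elim _ _))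

/-! ### The second pullback -/

theorem isPullback_inl (X Y : AConv M) :
    IsPullback (terminal.from X) (coprod.inl : X ⟶ X ⨿ Y)
      (coprod.inl : ⊤_ AConv M ⟶ (⊤_ AConv M) ⨿ ⊤_ AConv M)
      (coprod.map (terminal.from X) (terminal.from Y)) := by
  refine isPullback_of_ap (coprod.inl_map _ _).symm (fun x x' _ h => ?_) fun s z h => ?_
  -- The element `x` at hand supplies a retraction of the first coprojection.
  · have h' := congrArg (ap (coprod.desc (𝟙 X) (const x))) h
    rwa [← ap_comp, ← ap_comp, coprod.inl_desc] at h'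
  · obtain ⟨p, rfl⟩ := evalCoprod_surjective z
    rw [ap_map_evalCoprod, ← eval_unit _ s, ← evalCoprod_map_inl] at h
    obtain ⟨q, rfl⟩ := exists_map_inl_eq p (ap (terminal.from X)) (ap (terminal.from Y)) (by
      rw [← evalCoprod_terminal_injective h, map_apply_of_notMem_range _ _ _ (by simp)])
    exact ⟨X.eval q, Subsingleton.elim _ _, (evalCoprod_map_inl q).symm⟩

/-! ### Joint monicity -/

/-- The three elements of `1 + 1 + 1`. -/
noncomputable def threePoints (M : Type u) [EffectMonoid M] :
    ((⊤_ AConv M).A ⊕ (⊤_ AConv M).A) ⊕ (⊤_ AConv M).A →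
      (((⊤_ AConv M) ⨿ ⊤_ AConv M) ⨿ ⊤_ AConv M).A :=
  Sum.elim (ap coprod.inl ∘ coprodIncl _ _) (ap coprod.inr)

theorem eval_threePoints_surjective (z : (((⊤_ AConv M) ⨿ ⊤_ AConv M) ⨿ ⊤_ AConv M).A) :
    ∃ p, AConv.eval _ (Dist.map (threePoints M) p) = z := by
  let F := free M (((⊤_ AConv M).A ⊕ (⊤_ AConv M).A) ⊕ (⊤_ AConv M).A)
  let d : ((⊤_ AConv M) ⨿ ⊤_ AConv M) ⨿ ⊤_ AConv M ⟶ F :=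
    coprod.desc (coprod.desc (const (unit (Sum.inl (Sum.inl default))))
      (const (unit (Sum.inl (Sum.inr default))))) (const (unit (Sum.inr default)))
  have hd : d ≫ extend _ (threePoints M) = 𝟙 _ := by
    refine coprod.hom_ext (coprod.hom_ext ?_ ?_) ?_
    · rw [coprod.inl_desc_assoc, coprod.inl_desc_assoc]
      refine terminal_hom_ext ?_
      rw [ap_comp, ap_const, ap_extend, map_unit, eval_unit]
      rfl
    · rw [coprod.inl_desc_assoc, coprod.inr_desc_assoc]
      refine terminal_hom_ext ?_
      rw [ap_comp, ap_const, ap_extend, map_unit, eval_unit]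
      rfl
    · rw [coprod.inr_desc_assoc]
      refine terminal_hom_ext ?_
      rw [ap_comp, ap_const, ap_extend, map_unit, eval_unit]
      rfl
  refine ⟨ap d z, ?_⟩
  rw [← ap_extend, ← ap_comp, hd, ap_id]

theorem ap_eval_threePoints
    (m : ((⊤_ AConv M) ⨿ ⊤_ AConv M) ⨿ ⊤_ AConv M ⟶ (⊤_ AConv M) ⨿ ⊤_ AConv M)
    (t : ((⊤_ AConv M).A ⊕ (⊤_ AConv M).A) ⊕ (⊤_ AConv M).A → (⊤_ AConv M).A ⊕ (⊤_ AConv M).A)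
    (h : ∀ s, ap m (threePoints M s) = coprodIncl _ _ (t s)) (p) :
    ap m (AConv.eval _ (Dist.map (threePoints M) p)) = evalCoprod (Dist.map t p) := by
  rw [ap_eval, evalCoprod, map_map, map_map]
  simp only [h]

theorem jointly_monic_coprod_desc {Z : AConv M}
    {f g : Z ⟶ ((⊤_ AConv M) ⨿ ⊤_ AConv M) ⨿ ⊤_ AConv M}
    (h₁ : f ≫ coprod.desc (coprod.desc coprod.inl coprod.inr) coprod.inr
      = g ≫ coprod.desc (coprod.desc coprod.inl coprod.inr) coprod.inr)
    (h₂ : f ≫ coprod.desc (coprod.desc coprod.inr coprod.inl) coprod.inr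
      = g ≫ coprod.desc (coprod.desc coprod.inr coprod.inl) coprod.inr) : f = g := by
  refine hom_ext fun z => ?_
  obtain ⟨p, hp⟩ := eval_threePoints_surjective (ap f z)
  obtain ⟨q, hq⟩ := eval_threePoints_surjective (ap g z)
  have h₁' := congrArg (fun k => ap k z) h₁
  have h₂' := congrArg (fun k => ap k z) h₂
  simp only [ap_comp, ← hp, ← hq] at h₁' h₂'
  rw [ap_eval_threePoints _ (Sum.elim (Sum.elim Sum.inl Sum.inr) Sum.inr),
    ap_eval_threePoints _ (Sum.elim (Sum.elim Sum.inl Sum.inr) Sum.inr)] at h₁'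
  rw [ap_eval_threePoints _ (Sum.elim (Sum.elim Sum.inr Sum.inl) Sum.inr),
    ap_eval_threePoints _ (Sum.elim (Sum.elim Sum.inr Sum.inl) Sum.inr)] at h₂'
  · rw [← hp, ← hq]
    congr 2
    -- The weight at `inl` after the first map is that of the first point, and after the second map
    -- that of the second point. The third point is left to cancellation.
    refine ext_of_ne (Sum.inr default) ?_
    have e₁ := congrArg (fun r => r (Sum.inl default)) (evalCoprod_terminal_injective h₁')
    have e₂ := congrArg (fun r => r (Sum.inl default)) (evalCoprod_terminal_injective h₂')
    beta_reduce at e₁ e₂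
    rw [map_apply_eq (x := Sum.inl (Sum.inl default)),
      map_apply_eq (x := Sum.inl (Sum.inl default))] at e₁
    · rw [map_apply_eq (x := Sum.inl (Sum.inr default)),
        map_apply_eq (x := Sum.inl (Sum.inr default))] at e₂
      · rintro ((s | s) | s) hs
        · rwa [Subsingleton.elim s default]
        · rwa [Subsingleton.elim s default]
        · exact absurd (congrArg Sum.inr (Subsingleton.elim s default)) hs
      all_goals rintro ((s | s) | s) <;> simp
    all_goals rintro ((s | s) | s) <;> simp
  all_goals
    rintro ((s | s) | s)
    · refine congrArg (fun k => ap k s) (?_ : coprod.inl ≫ coprod.inl ≫ _ = _)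
      rw [coprod.inl_desc, coprod.inl_desc]
    · refine congrArg (fun k => ap k s) (?_ : coprod.inr ≫ coprod.inl ≫ _ = _)
      rw [coprod.inl_desc, coprod.inr_desc]
    · exact congrArg (fun k => ap k s) (coprod.inr_desc _ _)

end EffectMonoid

/-! ### The first pullback -/

section EffectDivisoid

variable {M : Type u} [EffectDivisoid M]

/-- The normalised `Y`-part of a representative has a value `y`; moving all the `Y`-weight to `y`
leaves `z` unchanged. -/
theorem exists_map_id_const_eq {X Y : AConv M} [Nonempty Y.A] (z : (X ⨿ Y).A) :
    ∃ y : Y.A, ap (coprod.map (𝟙 X) (const y : Y ⟶ Y)) z = z := by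
  obtain ⟨p, rfl⟩ := evalCoprod_surjective z
  obtain ⟨c, hc⟩ := exists_mix_inr p
  refine ⟨Y.eval c, ?_⟩
  conv_rhs => rw [← hc, evalCoprod, map_mix, eval_mix]
  rw [ap_evalCoprod, coprod.inl_map, coprod.inr_map]
  congr 2
  funext s
  rcases s with x | y
  · simp only [Sum.elim_inl, map_unit, eval_unit]
    rfl
  · simp only [Sum.elim_inr, map_map, ap_comp, ap_const, ap_eval]
    rfl

theorem exists_map_const_id_eq {X Y : AConv M} [Nonempty X.A] (z : (X ⨿ Y).A) :
    ∃ x : X.A, ap (coprod.map (const x : X ⟶ X) (𝟙 Y)) z = z := by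
  obtain ⟨x, hx⟩ := exists_map_id_const_eq (ap (coprod.braiding X Y).hom z)
  refine ⟨x, ?_⟩
  have h := congrArg (ap (coprod.braiding X Y).inv) hx
  rw [← ap_comp, ← ap_comp, ← ap_comp, Iso.hom_inv_id, ap_id] at h
  refine Eq.trans (congrArg (fun k => ap k z) ?_) h
  rw [coprod.braiding_hom, coprod.braiding_inv]
  apply coprod.hom_ext
  · rw [coprod.inl_desc_assoc, coprod.inr_map_assoc, coprod.inr_desc, coprod.inl_map]
  · rw [coprod.inr_desc_assoc, coprod.inl_map_assoc, coprod.inl_desc, coprod.inr_map]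

/-- A constant map factors through `1`, so this endomap sees only the image in `X + 1`. -/
theorem map_id_const {X Y : AConv M} (y : Y.A) :
    coprod.map (𝟙 X) (const y : Y ⟶ Y)
      = coprod.map (𝟙 X) (terminal.from Y) ≫ coprod.map (𝟙 X) (const y) := by
  rw [coprod.map_map, Category.comp_id]
  rfl

theorem map_const_id {X Y : AConv M} (x : X.A) :
    coprod.map (const x : X ⟶ X) (𝟙 Y)
      = coprod.map (terminal.from X) (𝟙 Y) ≫ coprod.map (const x) (𝟙 Y) := by
  rw [coprod.map_map, Category.comp_id]
  rfl

theorem coprod_jointly_injective {X Y : AConv M} {z z' : (X ⨿ Y).A}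
    (h₁ : ap (coprod.map (𝟙 X) (terminal.from Y)) z = ap (coprod.map (𝟙 X) (terminal.from Y)) z')
    (h₂ : ap (coprod.map (terminal.from X) (𝟙 Y)) z = ap (coprod.map (terminal.from X) (𝟙 Y)) z') :
    z = z' := by
  rcases isEmpty_or_nonempty X.A with hX | hX <;> rcases isEmpty_or_nonempty Y.A with hY | hY
  · obtain ⟨p, rfl⟩ := evalCoprod_surjective z
    obtain ⟨q, rfl⟩ := evalCoprod_surjective z'
    congr 1
    exact Dist.ext fun s => isEmptyElim s
  · obtain ⟨y⟩ := hY
    -- With `X` empty, any map on the `1` summand gives a left inverse of `! + id`; a point of `Y`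
    -- provides one.
    have h := congrArg (ap (coprod.desc (const (ap coprod.inr y)) coprod.inr :
      (⊤_ AConv M) ⨿ Y ⟶ X ⨿ Y)) h₂
    have e : coprod.map (terminal.from X) (𝟙 Y) ≫ coprod.desc (const (ap coprod.inr y)) coprod.inr
        = 𝟙 (X ⨿ Y) :=
      coprod.hom_ext (hom_ext fun x => isEmptyElim x) <| by
        rw [coprod.inr_map_assoc, coprod.inr_desc, Category.id_comp, Category.comp_id]
    rwa [← ap_comp, ← ap_comp, e] at h
  · obtain ⟨x⟩ := hX
    have h := congrArg (ap (coprod.desc coprod.inl (const (ap coprod.inl x)) :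
      X ⨿ ⊤_ AConv M ⟶ X ⨿ Y)) h₁
    have e : coprod.map (𝟙 X) (terminal.from Y) ≫ coprod.desc coprod.inl (const (ap coprod.inl x))
        = 𝟙 (X ⨿ Y) :=
      coprod.hom_ext
        (by rw [coprod.inl_map_assoc, coprod.inl_desc, Category.id_comp, Category.comp_id])
        (hom_ext fun y => isEmptyElim y)
    rwa [← ap_comp, ← ap_comp, e] at h
  -- The point `y` comes from `z` and `x` from `z'`: each endomap fixes one element and, by the
  -- hypotheses, carries the other to it.
  · obtain ⟨y, hy⟩ := exists_map_id_const_eq z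
    obtain ⟨x, hx⟩ := exists_map_const_id_eq z'
    have hy' : ap (coprod.map (𝟙 X) (const y : Y ⟶ Y)) z' = z := by
      rw [map_id_const, ap_comp] at hy ⊢
      rw [← h₁, hy]
    have hx' : ap (coprod.map (const x : X ⟶ X) (𝟙 Y)) z = z' := by
      rw [map_const_id, ap_comp] at hx ⊢
      rw [h₂, hx]
    -- Both composites are `const x + const y`. At `z'` the left side gives `z` and the right side
    -- gives `z'`.
    have e : coprod.map (const x : X ⟶ X) (𝟙 Y) ≫ coprod.map (𝟙 X) (const y : Y ⟶ Y)
        = coprod.map (𝟙 X) (const y : Y ⟶ Y) ≫ coprod.map (const x : X ⟶ X) (𝟙 Y) := by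
      simp
    have h := congrArg (fun k => ap k z') e
    simp only [ap_comp, hx, hy', hx'] at h
    exact h

theorem isPullback_coprod (X Y : AConv M) :
    IsPullback (coprod.map (𝟙 X) (terminal.from Y)) (coprod.map (terminal.from X) (𝟙 Y))
      (coprod.map (terminal.from X) (𝟙 (⊤_ AConv M)))
      (coprod.map (𝟙 (⊤_ AConv M)) (terminal.from Y)) := by
  refine isPullback_of_ap (by simp) (fun z z' => coprod_jointly_injective) fun z z' h => ?_
  obtain ⟨p, rfl⟩ := evalCoprod_surjective z
  obtain ⟨q, rfl⟩ := evalCoprod_surjective z'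
  rw [ap_map_evalCoprod, ap_map_evalCoprod] at h
  obtain ⟨r, rfl, rfl⟩ := exists_glue p q _ _ (evalCoprod_terminal_injective h)
  exact ⟨evalCoprod r, ap_map_evalCoprod _ _ _, ap_map_evalCoprod _ _ _⟩

end EffectDivisoid

end AConv

end Effectus

theorem mainTheorem5 (M : Type u) [Effectus.EffectDivisoid M] :
    Effectus.IsEffectusInTotalForm (Effectus.AConv M) where
  isPullback_left := Effectus.AConv.isPullback_coprod
  isPullback_right := Effectus.AConv.isPullback_inl
  jointly_monic _ _ _ := Effectus.AConv.jointly_monic_coprod_desc
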